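/- Let $V$ be a finite-dimensional real normed vector space and let $C\subset V$ be an open cone, that is, a non-empty open convex set that is invariant under multiplication by positive scalars and does not contain $0$. Assume that $C$ contains no (affine) line, and fix a basepoint $b\in C$. Write $y\le_C x$ if $x-y\in\overline{C}$. For $x\in C$ and $y\in \overline{C}\setminus\{0\}$ put $\mathrm{Funk}_C(y,x)=\log\inf\{\lambda>0 : y\le_C\lambda x\}$, and for $x,y\in C$ put $\mathrm{Hil}_C(x,y)=\mathrm{Funk}_C(x,y)+\mathrm{Funk}_C(y,x)$. A Hilbert horofunction is a function $h:C\to\mathbb{R}$ that lies in the closure, for uniform convergence on compact subsets of $C$, of the set of functions $\mathrm{Hil}_C(\cdot,z)-\mathrm{Hil}_C(b,z)$ with $z\in C$, but does not belong to this set. A Funk horofunction is a function $q:C\to\mathbb{R}$ that lies in the closure, for pointwise convergence, of the set of functions $\mathrm{Funk}_C(\cdot,p)-\mathrm{Funk}_C(b,p)$ with $p\in C$, but does not belong to this set. For $x\in\partial C\setminus\{0\}$, let $r_{C,x}:C\to\mathbb{R}$ be the function $r_{C,x}(y)=\mathrm{Funk}_C(x,y)-\mathrm{Funk}_C(x,b)$,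 and let $A_C(x)$ be the set of Funk horofunctions $q$ for which there is a sequence $(x_n)$ in $C$ converging to $x$ in $V$ such that $\mathrm{Funk}_C(\cdot,x_n)-\mathrm{Funk}_C(b,x_n)$ converges pointwise to $q$ on $C$. Then every Hilbert horofunction $h$ can be written as $h=r_{C,x}+q$ with $x\in\partial C\setminus\{0\}$ and $q\in A_C(x)$. This decomposition is unique up to scaling of $x$: if also $h=r_{C,y}+q'$ with $y\in\partial C\setminus\{0\}$ and $q'\in A_C(y)$, then $y=tx$ for some $t>0$, $r_{C,y}=r_{C,x}$ and $q'=q$. -/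

import Mathlib

open Set Filter Topology

noncomputable section

namespace HilbertGeometry

/-- Open cones: non-empty open convex subsets, invariant under multiplication by positive
scalars, and not containing the origin. -/
structure IsOpenCone {V : Type*} [NormedAddCommGroup V] [NormedSpace ℝ V] (C : Set V) :
    Prop where
  nonempty : C.Nonempty
  isOpen : IsOpen C
  convex : Convex ℝ C
  smul_mem : ∀ t : ℝ, 0 < t → ∀ x ∈ C, t • x ∈ C
  zero_notMem : (0 : V) ∉ C

/-- The set `C` contains no (affine) line `{x + t • v | t ∈ ℝ}` with `v ≠ 0`. -/
def ContainsNoLine {V : Type*} [NormedAddCommGroup V] [NormedSpace ℝ V] (C : Set V) : Prop :=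
  ∀ x v : V, v ≠ 0 → ¬ ∀ t : ℝ, x + t • v ∈ C

/-- The relation `x ≤_C y`, meaning that `y - x` is in the closure of `C`. -/
def ConeLE {V : Type*} [NormedAddCommGroup V] [NormedSpace ℝ V] (C : Set V) (x y : V) : Prop :=
  y - x ∈ closure C

/-- `M_C(y / x) = inf {s > 0 | y ≤_C s x}`. -/
def coneM {V : Type*} [NormedAddCommGroup V] [NormedSpace ℝ V] (C : Set V) (y x : V) : ℝ :=
  sInf {s : ℝ | 0 < s ∧ ConeLE C y (s • x)}

/-- The Funk metric `Funk_C(y, x) = log M_C(y / x)`, for `y` in `V` and `x` in `C`. -/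
def funk {V : Type*} [NormedAddCommGroup V] [NormedSpace ℝ V] (C : Set V) (y x : V) : ℝ :=
  Real.log (coneM C y x)

/-- The reverse Funk metric `rev_C(x, y) = Funk_C(y, x)`, for `x` in `C` and `y` in `V`. -/
def revFunk {V : Type*} [NormedAddCommGroup V] [NormedSpace ℝ V] (C : Set V) (x y : V) : ℝ :=
  funk C y x

/-- Hilbert's projective metric on the cone `C`. -/
def hilbert {V : Type*} [NormedAddCommGroup V] [NormedSpace ℝ V] (C : Set V) (x y : V) : ℝ :=
  funk C x y + funk C y x

/-- The function `f_{C,p} = Funk_C(·, p) - Funk_C(b, p)` on `C`, for `p` in `C`. -/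
def funkFn {V : Type*} [NormedAddCommGroup V] [NormedSpace ℝ V] (C : Set V) (b p : V) :
    C → ℝ :=
  fun y => funk C (y : V) p - funk C b p

/-- The function `r_{C,p} = rev_C(·, p) - rev_C(b, p)` on `C`. -/
def revFn {V : Type*} [NormedAddCommGroup V] [NormedSpace ℝ V] (C : Set V) (b p : V) :
    C → ℝ :=
  fun y => revFunk C (y : V) p - revFunk C b p

/-- The function `φ_z = Hil_C(·, z) - Hil_C(b, z)` on `C`, for `z` in `C`. -/
def hilbertFn {V : Type*} [NormedAddCommGroup V] [NormedSpace ℝ V] (C : Set V) (b z : V) :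
    C → ℝ :=
  fun y => hilbert C (y : V) z - hilbert C b z

/-- The horofunctions of the Hilbert geometry on `C` with basepoint `b`: the functions in the
closure of `{φ_z | z ∈ C}`, for uniform convergence on compact subsets of `C`, that are not
themselves of the form `φ_z` with `z ∈ C`. -/
def hilbertHorofunctions {V : Type*} [NormedAddCommGroup V] [NormedSpace ℝ V]
    (C : Set V) (b : V) : Set (C → ℝ) :=
  {h | UniformOnFun.ofFun {K : Set C | IsCompact K} h ∈
      closure (range fun z : C =>
        UniformOnFun.ofFun {K : Set C | IsCompact K} (hilbertFn C b (z : V)))} \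
    range fun z : C => hilbertFn C b (z : V)

/-- The horofunctions of the Funk geometry on `C` with basepoint `b`: the functions in the
closure of `{f_{C,p} | p ∈ C}`, for pointwise convergence on `C`, that are not themselves of
the form `f_{C,p}` with `p ∈ C`. -/
def funkHorofunctions {V : Type*} [NormedAddCommGroup V] [NormedSpace ℝ V]
    (C : Set V) (b : V) : Set (C → ℝ) :=
  closure (range fun p : C => funkFn C b (p : V)) \ range fun p : C => funkFn C b (p : V)

/-- The set `A_C(x)` of Funk horofunctions that are pointwise limits of `f_{C,u n}` along some
sequence `u` in `C` converging to `x` in `V`. -/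
def funkHorofunctionsAt {V : Type*} [NormedAddCommGroup V] [NormedSpace ℝ V]
    (C : Set V) (b x : V) : Set (C → ℝ) :=
  {q | q ∈ funkHorofunctions C b ∧
    ∃ u : ℕ → V, (∀ n, u n ∈ C) ∧ Tendsto u atTop (𝓝 x) ∧
      ∀ y : C, Tendsto (fun n => funkFn C b (u n) y) atTop (𝓝 (q y))}

end HilbertGeometry

end

/-! Everything rests on the splitting `φ_z = r_z + f_z` (`hilbertFn_eq_add`). Since `φ_z` depends
only on the ray of `z`, a defining sequence for `h` can be normalised to the unit sphere and a
subsequence converges to some `x ≠ 0`. If `x` were in `C`, continuity would give `h = φ_x`; so `x`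
is a boundary point. The reverse Funk part still converges there, to `r_x`, hence the Funk part
converges to `q = h - r_x`.

The remaining claims come from probing along `x + ε b`, `ε → 0`. A limit of Funk functions satisfies
`exp q ≤ ε` there if its points tend to `x` (`exp_le_of_tendsto`), whereas every Funk limit
satisfies `exp q' ≥ ε` (`le_exp_of_tendsto`). The upper bound excludes `q = f_p`, which is bounded
below along the probe. If `r_x + q = r_y + q'`, the two bounds together give `y ≤_C t x` with `t =
M(y / b) / M(x / b)`; exchanging roles and using that the closed cone is pointed gives `y = t x`. -/

namespace HilbertGeometry

section

variable {V : Type*} [NormedAddCommGroup V] [NormedSpace ℝ V] {C : Set V}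

/-! ### The closed cone and its order. -/

namespace IsOpenCone

/-- By convexity the midpoint of an interior point and a closure point is interior; doubling it
gives the sum. -/
theorem add_mem_of_mem_closure (hC : IsOpenCone C) {a d : V} (ha : a ∈ C) (hd : d ∈ closure C) :
    a + d ∈ C := by
  have h := hC.convex.combo_interior_closure_mem_interior (x := a) (y := d) (a := 1 / 2)
    (b := 1 / 2) (by rwa [hC.isOpen.interior_eq]) hd (by norm_num) (by norm_num) (by norm_num)
  rw [hC.isOpen.interior_eq] at h
  have h2 := hC.smul_mem 2 two_pos _ h
  rwa [← smul_add, smul_smul, show (2 : ℝ) * (1 / 2) = 1 by norm_num, one_smul] at h2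

theorem smul_mem_closure_of_pos (hC : IsOpenCone C) {t : ℝ} (ht : 0 < t) {d : V}
    (hd : d ∈ closure C) : t • d ∈ closure C :=
  map_mem_closure (continuous_const_smul t) hd fun x hx => hC.smul_mem t ht x hx

theorem zero_mem_closure (hC : IsOpenCone C) : (0 : V) ∈ closure C := by
  obtain ⟨a, ha⟩ := hC.nonempty
  have h : Tendsto (fun t : ℝ => t • a) (𝓝[>] 0) (𝓝 0) := by
    have : Tendsto (fun t : ℝ => t • a) (𝓝 0) (𝓝 ((0 : ℝ) • a)) :=
      (continuous_id.smul continuous_const).tendsto 0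
    rw [zero_smul] at this
    exact this.mono_left nhdsWithin_le_nhds
  refine mem_closure_of_tendsto h ?_
  filter_upwards [self_mem_nhdsWithin] with t ht
  exact hC.smul_mem t ht a ha

theorem smul_mem_closure (hC : IsOpenCone C) {t : ℝ} (ht : 0 ≤ t) {d : V}
    (hd : d ∈ closure C) : t • d ∈ closure C := by
  rcases ht.eq_or_lt with rfl | ht
  · rw [zero_smul]; exact hC.zero_mem_closure
  · exact hC.smul_mem_closure_of_pos ht hd

theorem add_mem_closure (hC : IsOpenCone C) {c d : V} (hc : c ∈ closure C)
    (hd : d ∈ closure C) : c + d ∈ closure C := by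
  have h := map_mem_closure (f := fun z => z + d) (t := closure C) (by fun_prop) hc
    fun _ hx => subset_closure (hC.add_mem_of_mem_closure hx hd)
  rwa [closure_closure] at h

/-- The closure of an open cone containing no line is pointed. -/
theorem eq_zero_of_neg_mem (hC : IsOpenCone C) (hline : ContainsNoLine C) {v : V}
    (hv : v ∈ closure C) (hv' : -v ∈ closure C) : v = 0 := by
  by_contra hne
  obtain ⟨a, ha⟩ := hC.nonempty
  refine hline a v hne fun t => hC.add_mem_of_mem_closure ha ?_
  rcases le_total 0 t with ht | ht
  · exact hC.smul_mem_closure ht hv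
  · simpa using hC.smul_mem_closure (neg_nonneg.2 ht) hv'

theorem exists_coneLE (hC : IsOpenCone C) {x : V} (hx : x ∈ C) (y : V) :
    ∃ s : ℝ, 0 < s ∧ ConeLE C y (s • x) := by
  have h : Tendsto (fun t : ℝ => x - t • y) (𝓝[>] 0) (𝓝 x) := by
    have : Tendsto (fun t : ℝ => x - t • y) (𝓝 0) (𝓝 (x - (0 : ℝ) • y)) :=
      (continuous_const.sub (continuous_id.smul continuous_const)).tendsto 0
    rw [zero_smul, sub_zero] at this
    exact this.mono_left nhdsWithin_le_nhds
  obtain ⟨t, ht, ht0⟩ :=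
    ((h.eventually (hC.isOpen.mem_nhds hx)).and self_mem_nhdsWithin).exists
  have ht0 : 0 < t := ht0
  refine ⟨t⁻¹, inv_pos.2 ht0, ?_⟩
  have := hC.smul_mem t⁻¹ (inv_pos.2 ht0) _ ht
  rw [smul_sub, inv_smul_smul₀ ht0.ne'] at this
  exact subset_closure this

end IsOpenCone

/-! ### The gauge `M(y / x)`: attainment, positivity, monotonicity. -/

theorem hilbertFn_eq_add (C : Set V) (b z : V) :
    hilbertFn C b z = revFn C b z + funkFn C b z := by
  funext y
  simp only [hilbertFn, hilbert, revFn, revFunk, funkFn, Pi.add_apply]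
  ring

theorem coneM_nonneg (C : Set V) (y x : V) : 0 ≤ coneM C y x :=
  Real.sInf_nonneg fun _ hs => hs.1.le

theorem coneM_le {y x : V} {s : ℝ} (hs : 0 < s) (h : ConeLE C y (s • x)) : coneM C y x ≤ s :=
  csInf_le ⟨0, fun _ ht => ht.1.le⟩ ⟨hs, h⟩

namespace IsOpenCone

theorem coneLE_coneM (hC : IsOpenCone C) {x : V} (hx : x ∈ C) (y : V) :
    ConeLE C y (coneM C y x • x) := by
  have hS : coneM C y x ∈ closure {s : ℝ | 0 < s ∧ ConeLE C y (s • x)} :=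
    csInf_mem_closure (hC.exists_coneLE hx y) ⟨0, fun _ ht => ht.1.le⟩
  have hcont : Continuous fun s : ℝ => s • x - y := by fun_prop
  have := map_mem_closure hcont hS (t := closure C) fun s hs => hs.2
  rwa [closure_closure] at this

theorem coneLE_of_coneM_le (hC : IsOpenCone C) {x y : V} (hx : x ∈ C) {s : ℝ}
    (h : coneM C y x ≤ s) : ConeLE C y (s • x) := by
  have h1 := hC.add_mem_closure (hC.coneLE_coneM hx y)
    (hC.smul_mem_closure (sub_nonneg.2 h) (subset_closure hx))
  have e : coneM C y x • x - y + (s - coneM C y x) • x = s • x - y := by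
    rw [sub_smul]; abel
  rwa [e] at h1

theorem coneM_le_of_nonneg (hC : IsOpenCone C) {x y : V} (hx : x ∈ C) {s : ℝ} (hs : 0 ≤ s)
    (h : ConeLE C y (s • x)) : coneM C y x ≤ s := by
  -- The infimum runs over `s > 0` only, so a possible `s = 0` is approached by `s + ε`.
  refine le_of_forall_pos_le_add fun ε hε => coneM_le (by positivity) ?_
  have h1 := hC.add_mem_closure h (hC.smul_mem_closure hε.le (subset_closure hx))
  have e : s • x - y + ε • x = (s + ε) • x - y := by
    rw [add_smul]; abel
  rwa [e] at h1

/-- The infimum is attained in the closed order, so the value `0` would put `-y` in the closed cone.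
Positivity keeps the logarithms away from the junk value at `0`. -/
theorem coneM_pos (hC : IsOpenCone C) (hline : ContainsNoLine C) {x y : V} (hx : x ∈ C)
    (hy : y ∈ closure C) (hy0 : y ≠ 0) : 0 < coneM C y x := by
  refine (coneM_nonneg C y x).lt_of_ne fun h => hy0 ?_
  have h1 : -y ∈ closure C := by
    have := hC.coneLE_coneM hx y
    rw [← h] at this
    simpa [ConeLE] using this
  exact hC.eq_zero_of_neg_mem hline hy h1

theorem coneM_pos_of_mem (hC : IsOpenCone C) (hline : ContainsNoLine C) {x y : V} (hx : x ∈ C)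
    (hy : y ∈ C) : 0 < coneM C y x :=
  hC.coneM_pos hline hx (subset_closure hy) (ne_of_mem_of_not_mem hy hC.zero_notMem)

/-- Monotonicity in the numerator: `y ≤ t y' + s x` gives `M(y / x) ≤ t M(y' / x) + s`. -/
theorem coneM_le_of_coneLE (hC : IsOpenCone C) {x y y' : V} (hx : x ∈ C) {t s : ℝ}
    (ht : 0 ≤ t) (hs : 0 ≤ s) (h : ConeLE C y (t • y' + s • x)) :
    coneM C y x ≤ t * coneM C y' x + s := by
  refine hC.coneM_le_of_nonneg hx (add_nonneg (mul_nonneg ht (coneM_nonneg _ _ _)) hs) ?_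
  have h1 := hC.add_mem_closure h (hC.smul_mem_closure ht (hC.coneLE_coneM hx y'))
  have e : t • y' + s • x - y + t • (coneM C y' x • x - y')
      = (t * coneM C y' x + s) • x - y := by
    rw [add_smul, smul_sub, smul_smul]; abel
  rwa [e] at h1

theorem mul_coneM_le (hC : IsOpenCone C) {x y y' : V} (hx : x ∈ C) {t : ℝ} (ht : 0 < t)
    (h : y - t • y' ∈ closure C) : t * coneM C y' x ≤ coneM C y x := by
  have h1 : ConeLE C y' (t⁻¹ • y + (0 : ℝ) • x) := by
    have := hC.smul_mem_closure (inv_pos.2 ht).le h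
    rw [smul_sub, inv_smul_smul₀ ht.ne'] at this
    simpa [ConeLE] using this
  have h2 := hC.coneM_le_of_coneLE hx (inv_pos.2 ht).le le_rfl h1
  rw [add_zero, ← div_eq_inv_mul, le_div_iff₀ ht] at h2
  linarith

/-! ### Continuity of the gauge in each variable. -/

theorem eventually_sub_add_mem (hC : IsOpenCone C) {ι : Type*} {l : Filter ι} {u : ι → V}
    {x w : V} (hw : w ∈ C) (hu : Tendsto u l (𝓝 x)) :
    ∀ᶠ n in l, u n - x + w ∈ C := by
  have h : Tendsto (fun n => u n - x + w) l (𝓝 w) := by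
    simpa using (hu.sub_const x).add_const w
  exact h.eventually (hC.isOpen.mem_nhds hw)

theorem eventually_sub_rev_add_mem (hC : IsOpenCone C) {ι : Type*} {l : Filter ι} {u : ι → V}
    {x w : V} (hw : w ∈ C) (hu : Tendsto u l (𝓝 x)) :
    ∀ᶠ n in l, x - u n + w ∈ C := by
  have h : Tendsto (fun n => x - u n + w) l (𝓝 w) := by
    simpa using (hu.const_sub x).add_const w
  exact h.eventually (hC.isOpen.mem_nhds hw)

theorem tendsto_coneM_left (hC : IsOpenCone C) {ι : Type*} {l : Filter ι} {u : ι → V} {x w : V}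
    (hw : w ∈ C) (hu : Tendsto u l (𝓝 x)) :
    Tendsto (fun n => coneM C (u n) w) l (𝓝 (coneM C x w)) := by
  rw [Metric.tendsto_nhds]
  intro ε hε
  have hw' := hC.smul_mem (ε / 2) (half_pos hε) w hw
  filter_upwards [hC.eventually_sub_add_mem hw' hu, hC.eventually_sub_rev_add_mem hw' hu]
    with n h1 h2
  have e1 : ConeLE C x ((1 : ℝ) • u n + (ε / 2) • w) := by
    rw [ConeLE, one_smul, add_sub_right_comm]; exact subset_closure h1
  have e2 : ConeLE C (u n) ((1 : ℝ) • x + (ε / 2) • w) := by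
    rw [ConeLE, one_smul, add_sub_right_comm]; exact subset_closure h2
  have m1 := hC.coneM_le_of_coneLE hw zero_le_one (half_pos hε).le e1
  have m2 := hC.coneM_le_of_coneLE hw zero_le_one (half_pos hε).le e2
  rw [Real.dist_eq, abs_lt]
  constructor <;> linarith

/-- Antitonicity in the denominator. -/
theorem coneM_le_mul (hC : IsOpenCone C) {x x' : V} (hx : x ∈ C) (hx' : x' ∈ C) (y : V) {t : ℝ}
    (ht : 0 ≤ t) (h : ConeLE C x (t • x')) : coneM C y x' ≤ t * coneM C y x := by
  refine hC.coneM_le_of_nonneg hx' (mul_nonneg ht (coneM_nonneg _ _ _)) ?_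
  have h1 := hC.add_mem_closure (hC.coneLE_coneM hx y)
    (hC.smul_mem_closure (coneM_nonneg C y x) h)
  have e : coneM C y x • x - y + coneM C y x • (t • x' - x)
      = (t * coneM C y x) • x' - y := by
    rw [smul_sub, smul_smul, mul_comm t]; abel
  rwa [e] at h1

theorem tendsto_coneM_right (hC : IsOpenCone C) {ι : Type*} {l : Filter ι} {u : ι → V} {x : V}
    (y : V) (hx : x ∈ C) (huC : ∀ n, u n ∈ C) (hu : Tendsto u l (𝓝 x)) :
    Tendsto (fun n => coneM C y (u n)) l (𝓝 (coneM C y x)) := by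
  have hg : Tendsto (fun t : ℝ => (1 + t)⁻¹ * coneM C y x) (𝓝 0) (𝓝 (coneM C y x)) := by
    have : ContinuousAt (fun t : ℝ => (1 + t)⁻¹ * coneM C y x) 0 := by
      refine ContinuousAt.mul (ContinuousAt.inv₀ (by fun_prop) (by norm_num)) continuousAt_const
    simpa [ContinuousAt] using this
  have hf : Tendsto (fun t : ℝ => (1 - t)⁻¹ * coneM C y x) (𝓝 0) (𝓝 (coneM C y x)) := by
    have : ContinuousAt (fun t : ℝ => (1 - t)⁻¹ * coneM C y x) 0 := by
      refine ContinuousAt.mul (ContinuousAt.inv₀ (by fun_prop) (by norm_num)) continuousAt_const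
    simpa [ContinuousAt] using this
  rw [tendsto_order]
  constructor
  -- Both bounds use that eventually `(1 - t) x ≤_C u n ≤_C (1 + t) x`, by openness at `t • x`.
  · intro a ha
    obtain ⟨t, hta, ht⟩ := (((hg.eventually (lt_mem_nhds ha)).filter_mono
      nhdsWithin_le_nhds).and (self_mem_nhdsWithin (s := Ioi (0 : ℝ)))).exists
    have ht : 0 < t := ht
    filter_upwards [hC.eventually_sub_rev_add_mem (hC.smul_mem t ht x hx) hu] with n hn
    have h1 : ConeLE C (u n) ((1 + t) • x) := by
      have e : (1 + t) • x - u n = x - u n + t • x := by rw [add_smul, one_smul]; abel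
      rw [ConeLE, e]; exact subset_closure hn
    have h2 := hC.coneM_le_mul (huC n) hx y (by positivity) h1
    refine hta.trans_le ?_
    rwa [inv_mul_le_iff₀ (by positivity)]
  · intro a ha
    obtain ⟨t, ⟨hta, ht1⟩, ht⟩ := ((((hf.eventually (gt_mem_nhds ha)).and
      (gt_mem_nhds one_pos)).filter_mono
      nhdsWithin_le_nhds).and (self_mem_nhdsWithin (s := Ioi (0 : ℝ)))).exists
    have ht : 0 < t := ht
    have ht' : 0 < 1 - t := sub_pos.2 ht1
    filter_upwards [hC.eventually_sub_add_mem (hC.smul_mem t ht x hx) hu] with n hn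
    have h1 : ConeLE C x ((1 - t)⁻¹ • u n) := by
      have h0 : u n - (1 - t) • x ∈ C := by
        have e : u n - (1 - t) • x = u n - x + t • x := by rw [sub_smul, one_smul]; abel
        rwa [e]
      have := hC.smul_mem _ (inv_pos.2 ht') _ h0
      rw [smul_sub, inv_smul_smul₀ ht'.ne'] at this
      exact subset_closure this
    exact (hC.coneM_le_mul hx (huC n) y (inv_pos.2 ht').le h1).trans_lt hta

/-! ### Scaling and limits of the normalised functions. -/

theorem coneM_smul_left (hC : IsOpenCone C) {x : V} (hx : x ∈ C) (y : V) {t : ℝ} (ht : 0 < t) :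
    coneM C (t • y) x = t * coneM C y x := by
  refine le_antisymm ?_ (hC.mul_coneM_le hx ht (by simpa using hC.zero_mem_closure))
  have := hC.coneM_le_of_coneLE (y := t • y) (y' := y) hx ht.le le_rfl
    (by simpa [ConeLE] using hC.zero_mem_closure)
  simpa using this

theorem coneM_smul_right (hC : IsOpenCone C) {x : V} (hx : x ∈ C) (y : V) {t : ℝ} (ht : 0 < t) :
    coneM C y (t • x) = t⁻¹ * coneM C y x := by
  have htx := hC.smul_mem t ht x hx
  refine le_antisymm (hC.coneM_le_mul hx htx y (inv_pos.2 ht).le ?_) ?_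
  · rw [ConeLE, inv_smul_smul₀ ht.ne', sub_self]; exact hC.zero_mem_closure
  · rw [inv_mul_le_iff₀ ht]
    refine hC.coneM_le_mul htx hx y ht.le ?_
    rw [ConeLE, sub_self]; exact hC.zero_mem_closure

theorem hilbertFn_smul (hC : IsOpenCone C) (hline : ContainsNoLine C) {b z : V} (hb : b ∈ C)
    (hz : z ∈ C) {t : ℝ} (ht : 0 < t) : hilbertFn C b (t • z) = hilbertFn C b z := by
  have key : ∀ y ∈ C, hilbert C y (t • z) = hilbert C y z := fun y hy => by
    have h1 := (hC.coneM_pos_of_mem hline hz hy).ne'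
    have h2 := (hC.coneM_pos_of_mem hline hy hz).ne'
    rw [hilbert, hilbert, funk, funk, funk, funk, hC.coneM_smul_right hz y ht,
      hC.coneM_smul_left hy z ht, Real.log_mul (inv_pos.2 ht).ne' h1, Real.log_mul ht.ne' h2,
      Real.log_inv]
    ring
  funext y
  simp only [hilbertFn, key y y.2, key b hb]

theorem tendsto_revFn (hC : IsOpenCone C) (hline : ContainsNoLine C) {b x : V} (hb : b ∈ C)
    (hx : x ∈ closure C) (hx0 : x ≠ 0) {u : ℕ → V} (hu : Tendsto u atTop (𝓝 x)) (y : C) :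
    Tendsto (fun n => revFn C b (u n) y) atTop (𝓝 (revFn C b x y)) :=
  ((hC.tendsto_coneM_left y.2 hu).log (hC.coneM_pos hline y.2 hx hx0).ne').sub
    ((hC.tendsto_coneM_left hb hu).log (hC.coneM_pos hline hb hx hx0).ne')

theorem tendsto_funkFn (hC : IsOpenCone C) (hline : ContainsNoLine C) {b x : V} (hb : b ∈ C)
    (hx : x ∈ C) {u : ℕ → V} (huC : ∀ n, u n ∈ C) (hu : Tendsto u atTop (𝓝 x)) (y : C) :
    Tendsto (fun n => funkFn C b (u n) y) atTop (𝓝 (funkFn C b x y)) :=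
  ((hC.tendsto_coneM_right y hx huC hu).log (hC.coneM_pos_of_mem hline hx y.2).ne').sub
    ((hC.tendsto_coneM_right b hx huC hu).log (hC.coneM_pos_of_mem hline hx hb).ne')

theorem exp_funkFn (hC : IsOpenCone C) (hline : ContainsNoLine C) {b p : V} (hb : b ∈ C)
    (hp : p ∈ C) (y : C) :
    Real.exp (funkFn C b p y) = coneM C y p / coneM C b p := by
  rw [funkFn, funk, funk, Real.exp_sub, Real.exp_log (hC.coneM_pos_of_mem hline hp y.2),
    Real.exp_log (hC.coneM_pos_of_mem hline hp hb)]

theorem exp_revFn (hC : IsOpenCone C) (hline : ContainsNoLine C) {b x : V} (hb : b ∈ C)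
    (hx : x ∈ closure C) (hx0 : x ≠ 0) (y : C) :
    Real.exp (revFn C b x y) = coneM C x y / coneM C x b := by
  rw [revFn, revFunk, revFunk, funk, funk, Real.exp_sub,
    Real.exp_log (hC.coneM_pos hline y.2 hx hx0), Real.exp_log (hC.coneM_pos hline hb hx hx0)]

/-! ### Funk limits near a boundary point. -/

/-- A bound `L` along infinitely many `n` would pass to the limit as `b ≤_C L x`, forcing `x` into
`C`. -/
theorem tendsto_coneM_atTop (hC : IsOpenCone C) {b x : V} (hb : b ∈ C)
    (hx : x ∉ C) {u : ℕ → V} (huC : ∀ n, u n ∈ C) (hu : Tendsto u atTop (𝓝 x)) :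
    Tendsto (fun n => coneM C b (u n)) atTop atTop := by
  rw [tendsto_atTop]
  intro K
  by_contra hcon
  set L := max K 1
  have hL : 0 < L := lt_max_of_lt_right one_pos
  have hfreq : ∃ᶠ n in atTop, L • u n - b ∈ closure C := by
    refine (not_eventually.1 hcon).mono fun n hn => ?_
    exact hC.coneLE_of_coneM_le (huC n) ((not_le.1 hn).le.trans (le_max_left _ _))
  have hmem : L • x - b ∈ closure C :=
    isClosed_closure.mem_of_frequently_of_tendsto hfreq ((hu.const_smul L).sub_const b)
  have h1 := hC.add_mem_of_mem_closure hb hmem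
  rw [add_sub_cancel] at h1
  have h2 := hC.smul_mem _ (inv_pos.2 hL) _ h1
  rw [inv_smul_smul₀ hL.ne'] at h2
  exact hx h2

theorem add_smul_mem (hC : IsOpenCone C) {b x : V} (hb : b ∈ C) (hx : x ∈ closure C) {ε : ℝ}
    (hε : 0 < ε) : x + ε • b ∈ C := by
  rw [add_comm]; exact hC.add_mem_of_mem_closure (hC.smul_mem ε hε b hb) hx

/-- A pointwise limit of the `f_{C,u n}` satisfies `exp (q (x + ε b)) ≥ ε`
at every `x` in the closure of the cone. -/
theorem le_exp_of_tendsto (hC : IsOpenCone C) (hline : ContainsNoLine C) {b x : V} (hb : b ∈ C)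
    (hx : x ∈ closure C) {u : ℕ → V} (huC : ∀ n, u n ∈ C) {q : C → ℝ}
    (hq : ∀ y : C, Tendsto (fun n => funkFn C b (u n) y) atTop (𝓝 (q y))) {ε : ℝ} (hε : 0 < ε) :
    ε ≤ Real.exp (q ⟨x + ε • b, hC.add_smul_mem hb hx hε⟩) := by
  refine ge_of_tendsto' (Real.continuous_exp.continuousAt.tendsto.comp (hq _)) fun n => ?_
  rw [Function.comp_apply, hC.exp_funkFn hline hb (huC n),
    le_div_iff₀ (hC.coneM_pos_of_mem hline (huC n) hb)]
  exact hC.mul_coneM_le (huC n) hε (by simpa using hx)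

/-- If `u n` tends to a boundary point `x`, then a pointwise limit of the `f_{C,u n}`
satisfies `exp (q (x + ε b)) ≤ ε`. -/
theorem exp_le_of_tendsto (hC : IsOpenCone C) (hline : ContainsNoLine C) {b x : V} (hb : b ∈ C)
    (hx : x ∈ closure C) (hxC : x ∉ C) {u : ℕ → V} (huC : ∀ n, u n ∈ C)
    (hu : Tendsto u atTop (𝓝 x)) {q : C → ℝ}
    (hq : ∀ y : C, Tendsto (fun n => funkFn C b (u n) y) atTop (𝓝 (q y))) {ε : ℝ} (hε : 0 < ε) :
    Real.exp (q ⟨x + ε • b, hC.add_smul_mem hb hx hε⟩) ≤ ε := by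
  refine le_of_forall_pos_le_add fun δ hδ => ?_
  -- The slack `δ b` absorbs `x - u n`, so `x + ε b ≤_C (ε + δ) b + u n`; after division by `M(b / u
  -- n)` the last term contributes a vanishing `1 / M(b / u n)`.
  have hlim : Tendsto (fun n => (ε + δ) + (coneM C b (u n))⁻¹) atTop (𝓝 ((ε + δ) + 0)) :=
    (tendsto_inv_atTop_zero.comp (hC.tendsto_coneM_atTop hb hxC huC hu)).const_add _
  rw [add_zero] at hlim
  refine le_of_tendsto_of_tendsto (Real.continuous_exp.continuousAt.tendsto.comp (hq _)) hlim ?_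
  filter_upwards [hC.eventually_sub_add_mem (hC.smul_mem δ hδ b hb) hu] with n hn
  have hM := hC.coneM_pos_of_mem hline (huC n) hb
  rw [Function.comp_apply, hC.exp_funkFn hline hb (huC n), div_le_iff₀ hM, add_mul,
    inv_mul_cancel₀ hM.ne']
  refine hC.coneM_le_of_coneLE (huC n) (by positivity) zero_le_one ?_
  have e : (ε + δ) • b + (1 : ℝ) • u n - (x + ε • b) = u n - x + δ • b := by
    rw [add_smul, one_smul]; abel
  rw [ConeLE, e]
  exact subset_closure hn

theorem notMem_of_mem_frontier (hC : IsOpenCone C) {x : V} (hx : x ∈ frontier C) : x ∉ C := by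
  rw [frontier, hC.isOpen.interior_eq] at hx
  exact hx.2

theorem mem_funkHorofunctionsAt (hC : IsOpenCone C) (hline : ContainsNoLine C) {b x : V}
    (hb : b ∈ C) (hx : x ∈ frontier C \ {0}) {u : ℕ → V} (huC : ∀ n, u n ∈ C)
    (hu : Tendsto u atTop (𝓝 x)) {q : C → ℝ}
    (hq : ∀ y : C, Tendsto (fun n => funkFn C b (u n) y) atTop (𝓝 (q y))) :
    q ∈ funkHorofunctionsAt C b x := by
  refine ⟨⟨?_, ?_⟩, u, huC, hu, hq⟩
  · exact mem_closure_of_tendsto (tendsto_pi_nhds.2 hq)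
      (Eventually.of_forall fun n => ⟨⟨u n, huC n⟩, rfl⟩)
  · rintro ⟨⟨p, hp⟩, rfl⟩
    have hxc : x ∈ closure C := frontier_subset_closure hx.1
    have hxM := hC.coneM_pos hline hp hxc hx.2
    have hbM := hC.coneM_pos_of_mem hline hp hb
    -- Half of the lower bound of `exp f_p` along the probe, so the upper bound `ε` is violated.
    set ε := coneM C x p / coneM C b p / 2 with hεdef
    have hpos : 0 < coneM C x p / coneM C b p := div_pos hxM hbM
    have hε : 0 < ε := half_pos hpos
    have h1 := hC.exp_le_of_tendsto hline hb hxc (hC.notMem_of_mem_frontier hx.1) huC hu hq hε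
    rw [hC.exp_funkFn hline hb hp] at h1
    have h2 : coneM C x p ≤ coneM C (x + ε • b) p := by
      have := hC.mul_coneM_le (y := x + ε • b) (y' := x) hp one_pos
        (by simpa using hC.smul_mem_closure hε.le (subset_closure hb))
      rwa [one_mul] at this
    have h3 : coneM C x p / coneM C b p ≤ ε := (by gcongr : _ ≤ _).trans h1
    linarith

/-! ### Uniqueness of the boundary ray. -/

theorem coneLE_of_revFn_add_eq (hC : IsOpenCone C) (hline : ContainsNoLine C) {b x y : V}
    (hb : b ∈ C) (hx : x ∈ frontier C \ {0}) (hy : y ∈ frontier C \ {0}) {q q' : C → ℝ}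
    (hq : q ∈ funkHorofunctionsAt C b x) (hq' : q' ∈ funkHorofunctionsAt C b y)
    (heq : revFn C b x + q = revFn C b y + q') :
    ConeLE C y ((coneM C y b / coneM C x b) • x) := by
  obtain ⟨-, u, huC, hu, hqu⟩ := hq
  obtain ⟨-, v, hvC, -, hqv⟩ := hq'
  have hxc := frontier_subset_closure hx.1
  have hyc := frontier_subset_closure hy.1
  have hxM := hC.coneM_pos hline hb hxc hx.2
  have hyM := hC.coneM_pos hline hb hyc hy.2
  set t := coneM C y b / coneM C x b with ht
  have key : ∀ ε : ℝ, 0 < ε → ConeLE C y (t • (x + ε • b)) := by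
    intro ε hε
    have hw := hC.add_smul_mem hb hxc hε
    refine hC.coneLE_of_coneM_le hw ?_
    have h1 := hC.exp_le_of_tendsto hline hb hxc (hC.notMem_of_mem_frontier hx.1) huC hu hqu hε
    have h2 := hC.le_exp_of_tendsto hline hb hxc hvC hqv hε
    have h3 := congrArg Real.exp (congrFun heq ⟨x + ε • b, hw⟩)
    rw [Pi.add_apply, Pi.add_apply, Real.exp_add, Real.exp_add,
      hC.exp_revFn hline hb hxc hx.2, hC.exp_revFn hline hb hyc hy.2] at h3
    have h4 : coneM C x (x + ε • b) ≤ 1 := by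
      refine coneM_le one_pos ?_
      simpa [ConeLE] using hC.smul_mem_closure hε.le (subset_closure hb)
    -- Both sides carry the same factor `ε`; cancelling it leaves a bound on `M(y / (x + ε b))`
    -- uniform in `ε`.
    have h5 : coneM C y (x + ε • b) / coneM C y b * ε ≤ 1 / coneM C x b * ε := by
      calc coneM C y (x + ε • b) / coneM C y b * ε
          ≤ coneM C y (x + ε • b) / coneM C y b * _ :=
            mul_le_mul_of_nonneg_left h2 (div_nonneg (coneM_nonneg _ _ _) hyM.le)
        _ = _ := h3.symm
        _ ≤ 1 / coneM C x b * ε := by gcongr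
    have h6 := le_of_mul_le_mul_right h5 hε
    rw [div_le_iff₀ hyM] at h6
    rw [ht]
    exact h6.trans_eq (by ring)
  have hlim : Tendsto (fun ε : ℝ => t • (x + ε • b) - y) (𝓝[>] 0) (𝓝 (t • x - y)) := by
    have hc : Continuous fun ε : ℝ => t • (x + ε • b) - y := by fun_prop
    have := hc.tendsto 0
    rw [zero_smul, add_zero] at this
    exact this.mono_left nhdsWithin_le_nhds
  refine isClosed_closure.mem_of_tendsto hlim ?_
  filter_upwards [self_mem_nhdsWithin] with ε hε
  exact key ε hε

theorem eq_smul_of_revFn_add_eq (hC : IsOpenCone C) (hline : ContainsNoLine C) {b x y : V}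
    (hb : b ∈ C) (hx : x ∈ frontier C \ {0}) (hy : y ∈ frontier C \ {0}) {q q' : C → ℝ}
    (hq : q ∈ funkHorofunctionsAt C b x) (hq' : q' ∈ funkHorofunctionsAt C b y)
    (heq : revFn C b x + q = revFn C b y + q') :
    0 < coneM C y b / coneM C x b ∧ y = (coneM C y b / coneM C x b) • x := by
  have hxM := hC.coneM_pos hline hb (frontier_subset_closure hx.1) hx.2
  have hyM := hC.coneM_pos hline hb (frontier_subset_closure hy.1) hy.2
  have ht : 0 < coneM C y b / coneM C x b := div_pos hyM hxM
  refine ⟨ht, ?_⟩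
  have h1 := hC.coneLE_of_revFn_add_eq hline hb hx hy hq hq' heq
  have h2 := hC.smul_mem_closure ht.le
    (hC.coneLE_of_revFn_add_eq hline hb hy hx hq' hq heq.symm)
  rw [smul_sub, smul_smul, div_mul_div_cancel₀ hxM.ne', div_self hyM.ne', one_smul] at h2
  refine (sub_eq_zero.1 (hC.eq_zero_of_neg_mem hline h1 ?_)).symm
  rwa [neg_sub]

theorem revFn_smul (hC : IsOpenCone C) (hline : ContainsNoLine C) {b x : V} (hb : b ∈ C)
    (hx : x ∈ closure C) (hx0 : x ≠ 0) {t : ℝ} (ht : 0 < t) :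
    revFn C b (t • x) = revFn C b x := by
  funext y
  simp only [revFn, revFunk, funk]
  rw [hC.coneM_smul_left y.2 x ht, hC.coneM_smul_left hb x ht,
    Real.log_mul ht.ne' (hC.coneM_pos hline y.2 hx hx0).ne',
    Real.log_mul ht.ne' (hC.coneM_pos hline hb hx hx0).ne']
  ring

end IsOpenCone

/-! ### Existence of a boundary limit. -/

/-- On a σ-compact locally compact space, points in the closure of a set for uniform convergence
on compact sets are pointwise limits of sequences in the set. -/
theorem exists_seq_tendsto_of_mem_closure_uniformOnFun {X ι : Type*} [TopologicalSpace X]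
    [WeaklyLocallyCompactSpace X] [SigmaCompactSpace X] {F : ι → X → ℝ} {f : X → ℝ}
    (hf : UniformOnFun.ofFun {K : Set X | IsCompact K} f ∈
      closure (range fun i => UniformOnFun.ofFun {K : Set X | IsCompact K} (F i))) :
    ∃ u : ℕ → ι, ∀ x, Tendsto (fun n => F (u n) x) atTop (𝓝 (f x)) := by
  let K : CompactExhaustion X := default
  -- A compact exhaustion makes the uniformity countably generated, so closure points are sequential
  -- limits.
  have : IsCountablyGenerated (uniformity (UniformOnFun X ℝ {K : Set X | IsCompact K})) :=
    UniformOnFun.isCountablyGenerated_uniformity _ (t := K) K.isCompact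
      (fun _ _ h => K.subset h) fun s hs => K.exists_superset_of_isCompact hs
  obtain ⟨g, hg, hlim⟩ := mem_closure_iff_seq_limit.1 hf
  choose u hu using hg
  refine ⟨u, fun x => ?_⟩
  have hcov : ⋃₀ {K : Set X | IsCompact K} = univ :=
    eq_univ_of_forall fun y => ⟨{y}, isCompact_singleton, rfl⟩
  have h := ((UniformOnFun.uniformContinuous_eval (β := ℝ) hcov x).continuous.tendsto _).comp hlim
  have e : g = fun n => UniformOnFun.ofFun {K : Set X | IsCompact K} (F (u n)) :=
    funext fun n => (hu n).symm
  rw [e] at h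
  exact h

namespace IsOpenCone

/-- A Hilbert horofunction is a pointwise limit of the `φ_{u n}` along a sequence in the cone
converging to a non-zero boundary point. -/
theorem exists_seq_tendsto_frontier [FiniteDimensional ℝ V] (hC : IsOpenCone C)
    (hline : ContainsNoLine C) {b : V} (hb : b ∈ C) {h : C → ℝ}
    (hh : h ∈ hilbertHorofunctions C b) :
    ∃ x ∈ frontier C \ {0}, ∃ u : ℕ → V, (∀ n, u n ∈ C) ∧ Tendsto u atTop (𝓝 x) ∧
      ∀ y : C, Tendsto (fun n => hilbertFn C b (u n) y) atTop (𝓝 (h y)) := by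
  have : ProperSpace V := FiniteDimensional.proper_real V
  have : LocallyCompactSpace C := hC.isOpen.locallyCompactSpace
  obtain ⟨hcl, hnot⟩ := hh
  obtain ⟨z, hz⟩ := exists_seq_tendsto_of_mem_closure_uniformOnFun hcl
  have hnorm : ∀ n, 0 < ‖(z n : V)‖ := fun n =>
    norm_pos_iff.2 (ne_of_mem_of_not_mem (z n).2 hC.zero_notMem)
  set v : ℕ → V := fun n => ‖(z n : V)‖⁻¹ • (z n : V) with hv
  have hvC : ∀ n, v n ∈ C := fun n => hC.smul_mem _ (inv_pos.2 (hnorm n)) _ (z n).2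
  have hvs : ∀ n, v n ∈ Metric.sphere (0 : V) 1 := fun n => by
    rw [mem_sphere_zero_iff_norm, hv, norm_smul, norm_inv, norm_norm,
      inv_mul_cancel₀ (hnorm n).ne']
  obtain ⟨x, hxs, φ, hφ, hx⟩ := (isCompact_sphere (0 : V) 1).tendsto_subseq hvs
  have hlim : ∀ y : C, Tendsto (fun n => hilbertFn C b ((v ∘ φ) n) y) atTop (𝓝 (h y)) := by
    intro y
    have h1 := (hz y).comp hφ.tendsto_atTop
    refine h1.congr fun n => ?_
    exact (congrFun (hC.hilbertFn_smul hline hb (z (φ n)).2 (inv_pos.2 (hnorm (φ n)))) y).symm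
  have hx0 : x ≠ 0 := by
    rintro rfl
    simp at hxs
  have hxc : x ∈ closure C := mem_closure_of_tendsto hx (Eventually.of_forall fun n => hvC (φ n))
  refine ⟨x, ⟨⟨hxc, fun hxi => ?_⟩, hx0⟩, v ∘ φ, fun n => hvC (φ n), hx, hlim⟩
  have hxC : x ∈ C := interior_subset hxi
  -- A limit inside `C` would make `h` equal to `φ_x`, which horofunctions exclude.
  refine hnot ⟨⟨x, hxC⟩, funext fun y => tendsto_nhds_unique ?_ (hlim y)⟩
  simp only [hilbertFn_eq_add, Pi.add_apply]
  exact (hC.tendsto_revFn hline hb hxc hx0 hx y).add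
    (hC.tendsto_funkFn hline hb hxC (fun n => hvC (φ n)) hx y)

end IsOpenCone

end

end HilbertGeometry

theorem mainTheorem7 {V : Type*} [NormedAddCommGroup V] [NormedSpace ℝ V]
    [FiniteDimensional ℝ V] (C : Set V) (hC : HilbertGeometry.IsOpenCone C)
    (hline : HilbertGeometry.ContainsNoLine C) (b : V) (hb : b ∈ C)
    (h : C → ℝ) (hh : h ∈ HilbertGeometry.hilbertHorofunctions C b) :
    ∃ x ∈ frontier C \ {0}, ∃ q ∈ HilbertGeometry.funkHorofunctionsAt C b x,
      h = HilbertGeometry.revFn C b x + q ∧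
      ∀ y ∈ frontier C \ {0}, ∀ q' ∈ HilbertGeometry.funkHorofunctionsAt C b y,
        h = HilbertGeometry.revFn C b y + q' →
          (∃ t : ℝ, 0 < t ∧ y = t • x) ∧
            HilbertGeometry.revFn C b y = HilbertGeometry.revFn C b x ∧ q' = q := by
  obtain ⟨x, hx, u, huC, hu, hlim⟩ := hC.exists_seq_tendsto_frontier hline hb hh
  have hxc := frontier_subset_closure hx.1
  have hq : h - HilbertGeometry.revFn C b x ∈ HilbertGeometry.funkHorofunctionsAt C b x := by
    refine hC.mem_funkHorofunctionsAt hline hb hx huC hu fun y => ?_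
    refine ((hlim y).sub (hC.tendsto_revFn hline hb hxc hx.2 hu y)).congr fun n => ?_
    rw [HilbertGeometry.hilbertFn_eq_add, Pi.add_apply, add_sub_cancel_left]
  have hsum : HilbertGeometry.revFn C b x + (h - HilbertGeometry.revFn C b x) = h :=
    add_sub_cancel _ _
  refine ⟨x, hx, _, hq, hsum.symm, fun y hy q' hq' heq => ?_⟩
  obtain ⟨ht, hyx⟩ := hC.eq_smul_of_revFn_add_eq hline hb hx hy hq hq' (hsum.trans heq)
  have hr : HilbertGeometry.revFn C b y = HilbertGeometry.revFn C b x :=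
    (congrArg (HilbertGeometry.revFn C b) hyx).trans (hC.revFn_smul hline hb hxc hx.2 ht)
  refine ⟨⟨_, ht, hyx⟩, hr, ?_⟩
  rw [heq, hr, add_sub_cancel_left]
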